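/- Write $\mathbb{R}_+=(0,\infty)$ and $s\circ_h t:=s+t\,h(s)$. Let $\varphi:\mathbb{R}_+\to\mathbb{R}_+$ be continuous and self-equivarying ($\varphi\in SE$) with limit function $\eta$; that is, $\varphi(x)=O(x)$ as $x\to\infty$ and $$\varphi(x\circ_\varphi t)/\varphi(x)\to\eta(t)\qquad(x\to\infty),\ \text{locally uniformly in } t\in\mathbb{R}_+ .$$ Let $B\subseteq(0,\infty)$ be Lebesgue measurable and non-null, let $f:\mathbb{R}_+\to\mathbb{R}_+$ be Lebesgue measurable, let $g:B\to\mathbb{R}_+$, and let $(a_q)_{q\in\mathbb{Q}}$ be real numbers. Suppose that the Kendall condition $$a_q f(q\circ_\varphi t)\to g(t)\qquad(q\to\infty,\ q\in\mathbb{Q}),\quad t\in B,\ \text{locally uniformly in } t,$$ holds, in the sense that for every $t\in B$ and $\varepsilon>0$ there are $\delta>0$ and $Q>0$ with $|a_q f(q\circ_\varphi s)-g(t)|<\varepsilon$ for all rational $q>Q$ and all real $s$ with $|s-t|<\delta$ (equivalently, $a_q f(q\circ_\varphi t_q)\to g(t)$ whenever $t_q\to t\in B$). Then $f$ is $\varphi$-regularly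 varying: there is a function $K:\mathbb{R}_+\to\mathbb{R}_+$ with $$f(x+t\varphi(x))/f(x)\to K(t)\qquad(x\to\infty)$$ for all $t>0$, locally uniformly in $t\in\mathbb{R}_+$; moreover $K$ is continuous and satisfies the Chudziak–Jabłońska equation $$K(u\circ_\eta v)=K(v)K(u)\qquad(u,v>0).\tag{CJ}$$ -/

import Mathlib

open Filter Topology Set MeasureTheory

/-- The Popa circle operation `s ∘_h t = s + t * h s`. -/
def popa (h : ℝ → ℝ) (s t : ℝ) : ℝ := s + t * h s

/-- `φ : (0,∞) → (0,∞)` is self-equivarying (`φ ∈ SE`) with limit function `η`: it is `O(x)` as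
`x → ∞`, and `φ (x ∘_φ t) / φ x → η t` as `x → ∞`, locally uniformly in `t ∈ (0,∞)`. -/
structure SelfEquivarying (φ η : ℝ → ℝ) : Prop where
  pos : ∀ x, 0 < x → 0 < φ x
  isBigO : φ =O[atTop] (fun x : ℝ => x)
  tendsto : TendstoLocallyUniformlyOn (fun x t : ℝ => φ (popa φ x t) / φ x) η atTop (Ioi 0)

/-- `f : (0,∞) → (0,∞)` is `φ`-regularly varying with limit function (kernel) `K`:
`f (x ∘_φ t) / f x → K t` as `x → ∞`, locally uniformly in `t ∈ (0,∞)`. -/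
def PhiRegularlyVarying (φ f K : ℝ → ℝ) : Prop :=
  TendstoLocallyUniformlyOn (fun x t : ℝ => f (popa φ x t) / f x) K atTop (Ioi 0)

/-- The Kendall condition along the rationals: `a_q f (q ∘_φ t) → g t` as `q → ∞` through `ℚ`,
for `t ∈ B`, locally uniformly in `t`. Locally uniform convergence at `t ∈ B` means that
`a_q f (q ∘_φ s)` is arbitrarily close to `g t` for all large rational `q` and all real `s` in a
neighbourhood of `t` (equivalently `a_q f (q ∘_φ t_q) → g t` whenever `t_q → t`). -/
def KendallAlongRat (φ f : ℝ → ℝ) (a : ℚ → ℝ) (B : Set ℝ) (g : ℝ → ℝ) : Prop :=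
  ∀ t ∈ B, Tendsto (fun p : ℚ × ℝ => a p.1 * f (popa φ (p.1 : ℝ) p.2))
    ((atTop : Filter ℚ) ×ˢ 𝓝 t) (𝓝 (g t))

/-- The Chudziak–Jabłońska equation `K (u ∘_η v) = K v * K u` on `(0,∞)`. -/
def ChudziakJablonska (η K : ℝ → ℝ) : Prop :=
  ∀ u v : ℝ, 0 < u → 0 < v → K (popa η u v) = K v * K u

/-! Call `u` admissible if the increment of `log f` from `x` to `x ∘_φ w` converges as `x → ∞`, `w →
u` jointly. For `s, t ∈ B`, dividing the Kendall limits at `t` and `s` cancels `a q`. Since `(q ∘_φ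
s) ∘_φ u` is asymptotically `q ∘_φ (s + u η(s))`, this makes `u = (t - s) / η s` admissible; the
base points `q ∘_φ s'`, `s'` near `s`, cover all large reals, so rationals suffice.

A non-null set has pairs of points arbitrarily close, so there are arbitrarily small positive
admissible `u`, and `s = t` shows that `0` is admissible with increment `0`. Admissibility is
preserved by `∘_η`. As `η ≥ 1` and `η` is bounded on `(0, T]`, iterates of a small step come close
to every `T > 0`; the increment at `0` controls the remaining gap, so every `T > 0` is admissible.
Exponentiating gives `K`; additivity of increments is (CJ). -/

/-- `log f (x ∘_φ w) - log f x → k` as `x → ∞` and `w → u` jointly. -/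
def HasLogIncrement (φ f : ℝ → ℝ) (u k : ℝ) : Prop :=
  Tendsto (fun p : ℝ × ℝ => Real.log (f (popa φ p.1 p.2)) - Real.log (f p.1))
    (atTop ×ˢ 𝓝 u) (𝓝 k)

/-! ### Self-equivarying functions and their limit `η` -/

namespace SelfEquivarying

variable {φ η : ℝ → ℝ}

theorem continuousOn_limit (hφ : SelfEquivarying φ η) (hφc : ContinuousOn φ (Ioi 0)) :
    ContinuousOn η (Ioi 0) := by
  refine hφ.tendsto.continuousOn (Eventually.frequently ?_)
  filter_upwards [eventually_gt_atTop 0] with x hx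
  have hmaps : MapsTo (fun t : ℝ => popa φ x t) (Ioi 0) (Ioi 0) := fun t ht => by
    have := mul_pos (mem_Ioi.1 ht) (hφ.pos x hx)
    simp only [popa, mem_Ioi]
    linarith
  refine ContinuousOn.div_const (hφc.comp ?_ hmaps) _
  unfold popa
  fun_prop

theorem tendsto_prod (hφ : SelfEquivarying φ η) (hφc : ContinuousOn φ (Ioi 0)) {u : ℝ}
    (hu : 0 < u) :
    Tendsto (fun p : ℝ × ℝ => φ (popa φ p.1 p.2) / φ p.1) (atTop ×ˢ 𝓝 u) (𝓝 (η u)) := by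
  have h := tendstoLocallyUniformlyOn_iff_forall_tendsto.1 hφ.tendsto u hu
  have hη := (hφ.continuousOn_limit hφc).continuousAt (Ioi_mem_nhds hu)
  rw [nhdsWithin_eq_nhds.2 (Ioi_mem_nhds hu)] at h
  have h2 : Tendsto (fun p : ℝ × ℝ => η p.2) (atTop ×ˢ 𝓝 u) (𝓝 (η u)) :=
    hη.tendsto.comp tendsto_snd
  exact h2.congr_uniformity h

theorem le_popa (hφ : SelfEquivarying φ η) {x t : ℝ} (hx : 0 < x) (ht : 0 ≤ t) :
    x ≤ popa φ x t := by
  have := mul_nonneg ht (hφ.pos x hx).le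
  simp only [popa]
  linarith

theorem tendsto_popa_atTop (hφ : SelfEquivarying φ η) {ι : Type*} {l : Filter ι} {X r : ι → ℝ}
    {u : ℝ} (hX : Tendsto X l atTop) (hr : Tendsto r l (𝓝 u)) (hu : 0 < u) :
    Tendsto (fun i => popa φ (X i) (r i)) l atTop := by
  refine tendsto_atTop_mono' l ?_ hX
  filter_upwards [hX.eventually_gt_atTop 0, hr.eventually (lt_mem_nhds hu)] with i h1 h2
  exact hφ.le_popa h1 h2.le

theorem tendsto_comp (hφ : SelfEquivarying φ η) (hφc : ContinuousOn φ (Ioi 0)) {ι : Type*}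
    {l : Filter ι} {X r : ι → ℝ} {u : ℝ} (hX : Tendsto X l atTop) (hr : Tendsto r l (𝓝 u))
    (hu : 0 < u) : Tendsto (fun i => φ (popa φ (X i) (r i)) / φ (X i)) l (𝓝 (η u)) :=
  (hφ.tendsto_prod hφc hu).comp (hX.prodMk hr)

/-- If `η t < 1`, iterating `x ↦ x ∘_φ t` would converge to a finite point at which `φ` vanishes. -/
theorem one_le_limit (hφ : SelfEquivarying φ η) (hφc : ContinuousOn φ (Ioi 0)) {t : ℝ}
    (ht : 0 < t) : 1 ≤ η t := by
  by_contra! hlt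
  obtain ⟨c, hc, hc1⟩ := exists_between hlt
  have hev : ∀ᶠ x in atTop, φ (popa φ x t) / φ x < max c 0 :=
    (hφ.tendsto_comp hφc tendsto_id tendsto_const_nhds ht).eventually
      (gt_mem_nhds (lt_max_of_lt_left hc))
  -- The sign of `η t` is not yet known; the maximum keeps the geometric ratio nonnegative.
  set q := max c 0 with hq
  have hq1 : q < 1 := max_lt hc1 one_pos
  have hq0 : 0 ≤ q := le_max_right _ _
  obtain ⟨X, hX0, hX⟩ := (atTop_basis' (1 : ℝ)).eventually_iff.1 hev
  let x : ℕ → ℝ := fun n => Nat.rec X (fun _ y => popa φ y t) n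
  have hxs : ∀ n, x (n + 1) = popa φ (x n) t := fun n => rfl
  have hxX : ∀ n, X ≤ x n := by
    intro n
    induction n with
    | zero => exact le_rfl
    | succ n ih => exact ih.trans (hφ.le_popa (by linarith) ht.le)
  have hpos : ∀ n, 0 < x n := fun n => by linarith [hxX n]
  have hbd : ∀ n, φ (x n) ≤ φ X * q ^ n := by
    intro n
    induction n with
    | zero => simp [x]
    | succ n ih =>
      have h1 : φ (x (n + 1)) < q * φ (x n) :=
        (div_lt_iff₀ (hφ.pos _ (hpos n))).1 (hX (hxX n))
      have h2 := mul_le_mul_of_nonneg_left ih hq0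
      rw [pow_succ]
      linarith
  have hcau : CauchySeq x := by
    refine cauchySeq_of_le_geometric q (t * φ X) hq1 fun n => ?_
    rw [hxs, popa, Real.dist_eq, show x n - (x n + t * φ (x n)) = -(t * φ (x n)) by ring, abs_neg,
      abs_of_pos (mul_pos ht (hφ.pos _ (hpos n))), mul_assoc]
    exact mul_le_mul_of_nonneg_left (hbd n) ht.le
  obtain ⟨y, hy⟩ := cauchySeq_tendsto_of_complete hcau
  have hy0 : 0 < y := by
    have := ge_of_tendsto' hy hxX
    linarith
  have h1 : Tendsto (fun n => φ (x n)) atTop (𝓝 (φ y)) :=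
    (hφc.continuousAt (Ioi_mem_nhds hy0)).tendsto.comp hy
  have h2 : Tendsto (fun n : ℕ => φ X * q ^ n) atTop (𝓝 0) := by
    simpa using (tendsto_pow_atTop_nhds_zero_of_lt_one hq0 hq1).const_mul (φ X)
  exact absurd (le_of_tendsto_of_tendsto' h1 h2 hbd) (not_le.2 (hφ.pos y hy0))

theorem popa_eq (hφ : SelfEquivarying φ η) {x : ℝ} (u w : ℝ)
    (hx' : 0 < popa φ x u) :
    popa φ (popa φ x u) ((w - u) / (φ (popa φ x u) / φ x)) = popa φ x w := by
  have h := (hφ.pos _ hx').ne'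
  generalize hy : popa φ x u = y at *
  rw [popa, div_div_eq_mul_div, div_mul_cancel₀ _ h, ← hy]
  simp only [popa]
  ring

theorem popa_popa (hφ : SelfEquivarying φ η) {x : ℝ} (hx : 0 < x) (u v : ℝ) :
    popa φ (popa φ x u) v = popa φ x (u + v * (φ (popa φ x u) / φ x)) := by
  have h := (hφ.pos x hx).ne'
  generalize hy : φ (popa φ x u) = z
  rw [popa, hy]
  simp only [popa]
  field_simp
  ring

/-- The Gołąb–Schinzel equation for the limit function. -/
theorem golab_schinzel (hφ : SelfEquivarying φ η) (hφc : ContinuousOn φ (Ioi 0)) {u v : ℝ}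
    (hu : 0 < u) (hv : 0 < v) : η (popa η u v) = η u * η v := by
  have h1 := hφ.tendsto_comp hφc tendsto_id (tendsto_const_nhds (x := u)) hu
  have hX := hφ.tendsto_popa_atTop tendsto_id (tendsto_const_nhds (x := u)) hu
  have h2 := hφ.tendsto_comp hφc hX (tendsto_const_nhds (x := v)) hv
  have h3 := h1.mul h2
  have hη := hφ.one_le_limit hφc hu
  have huv : 0 < popa η u v := by
    have : 0 < v * η u := by positivity
    simp only [popa]; linarith
  have h4 := hφ.tendsto_comp hφc tendsto_id
    ((h1.const_mul v).const_add u : Tendsto _ _ (𝓝 (popa η u v))) huv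
  refine tendsto_nhds_unique h4 (h3.congr' ?_)
  filter_upwards [eventually_gt_atTop 0] with x hx
  have hx' : 0 < popa φ x u := hx.trans_le (hφ.le_popa hx hu.le)
  simp only [id]
  rw [hφ.popa_popa hx, mul_comm, div_mul_div_cancel₀ (hφ.pos _ hx').ne']

/-- Continuity of `η` at `1` transfers to `0+`: Gołąb–Schinzel factors `η (1 ∘_η v)` as `η 1 * η v`,
and `η 1` cancels. -/
theorem tendsto_limit_zero (hφ : SelfEquivarying φ η) (hφc : ContinuousOn φ (Ioi 0)) :
    Tendsto η (𝓝[>] 0) (𝓝 1) := by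
  have h1 := hφ.one_le_limit hφc one_pos
  have h0 : η 1 ≠ 0 := by positivity
  have hη := (hφ.continuousOn_limit hφc).continuousAt (Ioi_mem_nhds one_pos)
  have hp : Tendsto (fun v : ℝ => popa η 1 v) (𝓝[>] 0) (𝓝 1) := by
    have : Tendsto (fun v : ℝ => popa η 1 v) (𝓝 0) (𝓝 (1 + 0 * η 1)) := by
      unfold popa
      exact (by fun_prop : Continuous fun v : ℝ => 1 + v * η 1).tendsto 0
    rw [zero_mul, add_zero] at this
    exact this.mono_left nhdsWithin_le_nhds
  have h2 := (hη.tendsto.comp hp).div_const (η 1)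
  rw [div_self h0] at h2
  refine h2.congr' ?_
  filter_upwards [self_mem_nhdsWithin] with v hv
  simp only [Function.comp]
  rw [hφ.golab_schinzel hφc one_pos hv, mul_div_cancel_left₀ _ h0]

theorem limit_bddAbove_Ioc (hφ : SelfEquivarying φ η) (hφc : ContinuousOn φ (Ioi 0)) (T : ℝ) :
    ∃ M, ∀ u ∈ Ioc 0 T, η u ≤ M := by
  have h := (hφ.tendsto_limit_zero hφc).eventually (gt_mem_nhds one_lt_two)
  obtain ⟨d, hd, hd2⟩ := mem_nhdsGT_iff_exists_Ioo_subset.1 h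
  have hcont : ContinuousOn η (Icc d T) :=
    (hφ.continuousOn_limit hφc).mono fun x hx => lt_of_lt_of_le hd hx.1
  obtain ⟨M, hM⟩ := isCompact_Icc.bddAbove_image hcont
  refine ⟨max 2 M, fun u hu => ?_⟩
  rcases lt_or_ge u d with h | h
  · exact le_max_of_le_left (le_of_lt (hd2 ⟨hu.1, h⟩))
  · exact le_max_of_le_right (hM (mem_image_of_mem _ ⟨h, hu.2⟩))

theorem exists_popa_eq (hφ : SelfEquivarying φ η) (hφc : ContinuousOn φ (Ioi 0)) {t : ℝ}
    (ht : 0 < t) {X y : ℝ} (hX : 0 < X) (hy : popa φ X t ≤ y) : ∃ x, X ≤ x ∧ popa φ x t = y := by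
  have hXy : X ≤ y := (hφ.le_popa hX ht.le).trans hy
  have hc : ContinuousOn (fun x => popa φ x t) (Icc X y) :=
    continuousOn_id.add (continuousOn_const.mul
      (hφc.mono fun x hx => lt_of_lt_of_le hX hx.1))
  obtain ⟨x, hx, h⟩ := intermediate_value_Icc hXy hc
    ⟨hy, hφ.le_popa (hX.trans_le hXy) ht.le⟩
  exact ⟨x, hx.1, h⟩

/-- Every large real is of the form `q ∘_φ s` with `q` a large rational and `s` near `t`. -/
theorem atTop_le_map_popa_rat (hφ : SelfEquivarying φ η) (hφc : ContinuousOn φ (Ioi 0)) {t : ℝ}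
    (ht : 0 < t) :
    (atTop : Filter ℝ) ≤
      map (fun p : ℚ × ℝ => popa φ (p.1 : ℝ) p.2) ((atTop : Filter ℚ) ×ˢ 𝓝 t) := by
  intro S hS
  rw [mem_map, mem_prod_iff] at hS
  obtain ⟨U, hU, V, hV, hUV⟩ := hS
  obtain ⟨Q, hQ⟩ := mem_atTop_sets.1 hU
  set X : ℝ := max (Q : ℝ) 0 + 1 with hXdef
  have hX : 0 < X := by have := le_max_right (Q : ℝ) 0; linarith
  have hXQ : (Q : ℝ) < X := by have := le_max_left (Q : ℝ) 0; linarith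
  filter_upwards [eventually_ge_atTop (popa φ X t)] with y hy
  obtain ⟨x, hXx, hxy⟩ := hφ.exists_popa_eq hφc ht hX hy
  have hx : 0 < x := hX.trans_le hXx
  have hφx := hφ.pos x hx
  -- With `y` fixed, the parameter carrying base `z` to `y` is continuous in `z`, so `x` can be
  -- moved to a nearby rational.
  have hc : ContinuousAt (fun z => (y - z) / φ z) x :=
    (continuousAt_const.sub continuousAt_id).div (hφc.continuousAt (Ioi_mem_nhds hx)) hφx.ne'
  have hval : (y - x) / φ x = t := by
    rw [← hxy, popa, add_sub_cancel_left, mul_div_cancel_right₀ _ hφx.ne']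
  have hnear : ∀ᶠ z in 𝓝 x, (y - z) / φ z ∈ V := hc.eventually (by
    show V ∈ 𝓝 ((y - x) / φ x)
    rwa [hval])
  have hnear' := hnear.and (lt_mem_nhds (max_lt (hXQ.trans_le hXx) hx))
  obtain ⟨q, hq⟩ := Rat.denseRange_cast.exists_mem_open isOpen_interior
    ⟨x, mem_interior_iff_mem_nhds.2 hnear'⟩
  obtain ⟨hq1, hq2⟩ := interior_subset hq
  have hqQ : Q < q := by exact_mod_cast (le_max_left _ _).trans_lt hq2
  have hq0 : (0 : ℝ) < q := (le_max_right _ _).trans_lt hq2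
  have hmem : popa φ (q : ℝ) ((y - q) / φ q) ∈ S := hUV (a := (q, (y - q) / φ q)) ⟨hQ q hqQ.le, hq1⟩
  rwa [popa, div_mul_cancel₀ _ (hφ.pos _ hq0).ne', add_sub_cancel] at hmem

end SelfEquivarying

/-- On an `ε`-separated set `t ↦ ⌊t / ε⌋` is injective, so the set is countable, hence null. -/
theorem exists_pair_close {B : Set ℝ} (hB0 : volume B ≠ 0) {ε : ℝ} (hε : 0 < ε) :
    ∃ s ∈ B, ∃ t ∈ B, s < t ∧ t - s < ε := by
  by_contra! hsep
  refine hB0 (Set.Countable.measure_zero ?_ volume)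
  refine Set.MapsTo.countable_of_injOn (f := fun t : ℝ => ⌊t / ε⌋) (mapsTo_univ _ _) ?_
    (Set.to_countable univ)
  have key : ∀ s ∈ B, ∀ t ∈ B, ⌊s / ε⌋ = ⌊t / ε⌋ → ¬ s < t := by
    intro s hs t ht hst hlt
    have h1 := Int.abs_sub_lt_one_of_floor_eq_floor hst
    have h2 := hsep s hs t ht hlt
    rw [← sub_div, abs_lt, lt_div_iff₀ hε] at h1
    linarith [h1.1]
  intro s hs t ht hst
  rcases lt_trichotomy s t with h | h | h
  · exact absurd h (key s hs t ht hst)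
  · exact h
  · exact absurd h (key t ht s hs hst.symm)

/-! ### Admissible increments of `log f` -/

section Kernel

variable {φ η f g : ℝ → ℝ} {a : ℚ → ℝ} {B : Set ℝ}

theorem KendallAlongRat.hasLogIncrement (hφ : SelfEquivarying φ η) (hφc : ContinuousOn φ (Ioi 0))
    (hB : B ⊆ Ioi 0) (hf : ∀ x, 0 < x → 0 < f x) (hg : ∀ t ∈ B, 0 < g t)
    (hK : KendallAlongRat φ f a B g) {s t : ℝ} (hs : s ∈ B) (ht : t ∈ B) :
    HasLogIncrement φ f ((t - s) / η s) (Real.log (g t) - Real.log (g s)) := by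
  set u := (t - s) / η s with hu
  have hs0 : 0 < s := hB hs
  have ht0 : 0 < t := hB ht
  have hη := hφ.one_le_limit hφc hs0
  set m : ℚ × ℝ → ℝ := fun p => popa φ (p.1 : ℝ) p.2 with hm
  have hle : (atTop : Filter ℝ) ×ˢ 𝓝 u ≤
      map (Prod.map m id) (((atTop : Filter ℚ) ×ˢ 𝓝 s) ×ˢ 𝓝 u) := by
    rw [← prod_map_map_eq', map_id]
    exact prod_mono (hφ.atTop_le_map_popa_rat hφc hs0) le_rfl
  refine Tendsto.mono_left (tendsto_map'_iff.2 ?_) hle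
  have hfst : Tendsto (fun p : (ℚ × ℝ) × ℝ => p.1) (((atTop : Filter ℚ) ×ˢ 𝓝 s) ×ˢ 𝓝 u)
    ((atTop : Filter ℚ) ×ˢ 𝓝 s) := tendsto_fst
  have hq : Tendsto (fun p : (ℚ × ℝ) × ℝ => p.1.1) (((atTop : Filter ℚ) ×ˢ 𝓝 s) ×ˢ 𝓝 u) atTop :=
    tendsto_fst.comp hfst
  have hqR : Tendsto (fun p : (ℚ × ℝ) × ℝ => (p.1.1 : ℝ)) (((atTop : Filter ℚ) ×ˢ 𝓝 s) ×ˢ 𝓝 u)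
    atTop := tendsto_ratCast_atTop_iff.2 hq
  have hr : Tendsto (fun p : (ℚ × ℝ) × ℝ => p.1.2) (((atTop : Filter ℚ) ×ˢ 𝓝 s) ×ˢ 𝓝 u) (𝓝 s) :=
    tendsto_snd.comp hfst
  have hw : Tendsto (fun p : (ℚ × ℝ) × ℝ => p.2) (((atTop : Filter ℚ) ×ˢ 𝓝 s) ×ˢ 𝓝 u) (𝓝 u) :=
    tendsto_snd
  have hr' := hr.add (hw.mul (hφ.tendsto_comp hφc hqR hr hs0))
  have hval : s + u * η s = t := by
    rw [hu, div_mul_cancel₀ _ (by positivity)]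
    ring
  rw [hval] at hr'
  have k1 := (hK s hs).comp (hq.prodMk hr)
  have k2 := (hK t ht).comp (hq.prodMk hr')
  have l1 := (Real.continuousAt_log (hg s hs).ne').tendsto.comp k1
  have l2 := (Real.continuousAt_log (hg t ht).ne').tendsto.comp k2
  refine (l2.sub l1).congr' ?_
  filter_upwards [hqR.eventually_gt_atTop 0, hr.eventually (lt_mem_nhds hs0),
    hr'.eventually (lt_mem_nhds ht0), k1.eventually (lt_mem_nhds (hg s hs))] with p h1 h2 h3 h4
  -- The product `a q * f _` is eventually positive, its limit `g s` being so.
  have ha : a p.1.1 ≠ 0 := by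
    rintro h
    simp [h] at h4
  have hx1 := hf _ (h1.trans_le (hφ.le_popa h1 h2.le))
  have hx2 := hf _ (h1.trans_le (hφ.le_popa h1 h3.le))
  simp only [Function.comp, Prod.map, id, hm]
  rw [hφ.popa_popa h1, Real.log_mul ha hx1.ne', Real.log_mul ha hx2.ne']
  ring

namespace HasLogIncrement

/-- Increments along `x ↦ x ∘_φ u` and then `x ↦ x ∘_φ v` add up. -/
theorem comp (hφ : SelfEquivarying φ η) (hφc : ContinuousOn φ (Ioi 0)) {u v k l : ℝ}
    (hu : 0 < u) (h1 : HasLogIncrement φ f u k) (h2 : HasLogIncrement φ f v l) :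
    HasLogIncrement φ f (popa η u v) (k + l) := by
  set L := (atTop : Filter ℝ) ×ˢ 𝓝 (popa η u v)
  have hx : Tendsto (fun p : ℝ × ℝ => p.1) L atTop := tendsto_fst
  have hw : Tendsto (fun p : ℝ × ℝ => p.2) L (𝓝 (popa η u v)) := tendsto_snd
  have hc : Tendsto (fun _ : ℝ × ℝ => u) L (𝓝 u) := tendsto_const_nhds
  have hη := hφ.one_le_limit hφc hu
  have hη0 : η u ≠ 0 := by positivity
  have hr := (hw.sub_const u).div (hφ.tendsto_comp hφc hx hc hu) hη0
  have hval : (popa η u v - u) / η u = v := by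
    rw [popa, add_sub_cancel_left, mul_div_cancel_right₀ _ hη0]
  rw [hval] at hr
  have t1 := Tendsto.comp h1 (hx.prodMk hc)
  have t2 := Tendsto.comp h2 ((hφ.tendsto_popa_atTop hx hc hu).prodMk hr)
  refine (t1.add t2).congr' ?_
  filter_upwards [hx.eventually_gt_atTop 0] with p hp
  simp only [Function.comp, Pi.div_apply]
  rw [hφ.popa_eq _ _ (hp.trans_le (hφ.le_popa hp hu.le))]
  ring

/-- The set of `u > 0` along which the increments converge is closed in `(0, ∞)`. -/
theorem exists_of_approx (hφ : SelfEquivarying φ η) (hφc : ContinuousOn φ (Ioi 0))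
    (h0 : HasLogIncrement φ f 0 0) {T : ℝ}
    (happrox : ∀ ε > 0, ∃ u k, 0 < u ∧ |T - u| < ε ∧ HasLogIncrement φ f u k) :
    ∃ k, HasLogIncrement φ f T k := by
  refine CompleteSpace.complete (Metric.cauchy_iff.2 ⟨inferInstance, fun e he => ?_⟩)
  have h0' := h0 (Metric.ball_mem_nhds 0 (show 0 < e / 4 by linarith))
  rw [mem_map, mem_prod_iff] at h0'
  obtain ⟨U, hU, V, hV, hUV⟩ := h0'
  obtain ⟨d, hd, hdV⟩ := Metric.mem_nhds_iff.1 hV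
  -- The residual step from `x ∘_φ u` is divided by a ratio eventually above `1 / 2` (as `η u ≥ 1`),
  -- so `d / 2` keeps it below `d`.
  obtain ⟨u, k, hu, hTu, hk⟩ := happrox (d / 2) (by linarith)
  set L := (atTop : Filter ℝ) ×ˢ 𝓝 T
  have hx : Tendsto (fun p : ℝ × ℝ => p.1) L atTop := tendsto_fst
  have hw : Tendsto (fun p : ℝ × ℝ => p.2) L (𝓝 T) := tendsto_snd
  have hc : Tendsto (fun _ : ℝ × ℝ => u) L (𝓝 u) := tendsto_const_nhds
  have hη := hφ.one_le_limit hφc hu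
  have hratio := hφ.tendsto_comp hφc hx hc hu
  have hX := hφ.tendsto_popa_atTop hx hc hu
  have t1 := Tendsto.comp hk (hx.prodMk hc)
  have hclose : ∀ᶠ p in L, Real.log (f (popa φ p.1 p.2)) - Real.log (f p.1) ∈
      Metric.ball k (e / 2) := by
    filter_upwards [hx.eventually_gt_atTop 0, hX.eventually hU,
      hratio.eventually (lt_mem_nhds (show 1 / 2 < η u by linarith)),
      ((hw.sub_const u).abs).eventually (gt_mem_nhds hTu),
      t1 (Metric.ball_mem_nhds k (show 0 < e / 4 by linarith))] with p hp hpU hpr hpT hpk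
    have hmem : (p.2 - u) / (φ (popa φ p.1 u) / φ p.1) ∈ V := by
      apply hdV
      rw [mem_ball_zero_iff, Real.norm_eq_abs, abs_div,
        abs_of_pos (show 0 < φ (popa φ p.1 u) / φ p.1 by linarith),
        div_lt_iff₀ (by linarith)]
      nlinarith
    have h2 := hUV (mk_mem_prod hpU hmem)
    simp only [mem_preimage, Function.comp, Metric.mem_ball, Real.dist_eq] at h2 hpk ⊢
    rw [hφ.popa_eq _ _ (hp.trans_le (hφ.le_popa hp hu.le)), sub_zero] at h2
    rw [abs_lt] at *
    constructor <;> linarith [h2.1, h2.2, hpk.1, hpk.2]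
  refine ⟨Metric.ball k (e / 2), hclose, fun x hx y hy => ?_⟩
  have := dist_triangle_right x y k
  rw [Metric.mem_ball] at hx hy
  linarith

/-- A single arbitrarily small step generates, under iteration, points close to any `T > 0`. -/
theorem exists_close (hφ : SelfEquivarying φ η) (hφc : ContinuousOn φ (Ioi 0))
    (hsmall : ∀ ε > 0, ∃ u k, 0 < u ∧ u < ε ∧ HasLogIncrement φ f u k) {T : ℝ} (hT : 0 < T)
    {ε : ℝ} (hε : 0 < ε) : ∃ u k, 0 < u ∧ |T - u| < ε ∧ HasLogIncrement φ f u k := by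
  obtain ⟨M, hM⟩ := hφ.limit_bddAbove_Ioc hφc T
  have hM1 : 1 ≤ M := (hφ.one_le_limit hφc hT).trans (hM T ⟨hT, le_rfl⟩)
  have hM0 : 0 < M := by linarith
  -- The bound `T` starts the iteration below `T`; the bound `ε / M` makes each step `u * η (v n)`
  -- with `v n ≤ T` shorter than `ε`.
  obtain ⟨u, k, hu, huε, hk⟩ := hsmall (min T (ε / M)) (by positivity)
  let v : ℕ → ℝ := fun n => Nat.rec u (fun _ y => popa η y u) n
  have hvs : ∀ n, v (n + 1) = v n + u * η (v n) := fun n => rfl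
  have hv : ∀ n, (n + 1) * u ≤ v n ∧ ∃ l, HasLogIncrement φ f (v n) l := by
    intro n
    induction n with
    | zero => exact ⟨by simp [v], k, hk⟩
    | succ n ih =>
      obtain ⟨h1, l, hl⟩ := ih
      have h0 : 0 < v n := lt_of_lt_of_le (by positivity) h1
      refine ⟨?_, l + k, hl.comp hφ hφc h0 hk⟩
      rw [hvs]
      push_cast
      have := mul_le_mul_of_nonneg_left (hφ.one_le_limit hφc h0) hu.le
      linarith
  have hv0 : ∀ n, 0 < v n := fun n => lt_of_lt_of_le (by positivity) (hv n).1
  have hex : ∃ n, T < v n := by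
    obtain ⟨n, hn⟩ := exists_nat_gt (T / u)
    refine ⟨n, lt_of_lt_of_le ?_ (hv n).1⟩
    rw [div_lt_iff₀ hu] at hn
    linarith
  obtain ⟨n, hle, hgt⟩ : ∃ n, v n ≤ T ∧ T < v (n + 1) := by
    by_contra! h
    obtain ⟨N, hN⟩ := hex
    have hall : ∀ n, v n ≤ T := by
      intro n
      induction n with
      | zero => exact (huε.trans_le (min_le_left _ _)).le
      | succ n ih => exact h n ih
    exact absurd hN (not_lt.2 (hall N))
  obtain ⟨l, hl⟩ := (hv n).2
  refine ⟨v n, l, hv0 n, ?_, hl⟩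
  rw [hvs] at hgt
  have h1 := mul_le_mul_of_nonneg_left (hM (v n) ⟨hv0 n, hle⟩) hu.le
  have h2 := (lt_div_iff₀ hM0).1 (huε.trans_le (min_le_right _ _))
  rw [abs_of_nonneg (by linarith)]
  linarith

end HasLogIncrement

/-- Continuous convergence forces continuity of the limit. -/
theorem continuousOn_of_tendsto_prod {F : ℝ → ℝ → ℝ} {K : ℝ → ℝ} {s : Set ℝ} (hs : IsOpen s)
    (h : ∀ t ∈ s, Tendsto (fun p : ℝ × ℝ => F p.1 p.2) (atTop ×ˢ 𝓝 t) (𝓝 (K t))) :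
    ContinuousOn K s := by
  intro t ht
  refine ContinuousAt.continuousWithinAt (Metric.nhds_basis_closedBall.tendsto_right_iff.2 ?_)
  intro e he
  have h1 := h t ht (Metric.closedBall_mem_nhds _ he)
  rw [mem_map, mem_prod_iff] at h1
  obtain ⟨U, hU, V, hV, hUV⟩ := h1
  filter_upwards [hV, hs.mem_nhds ht] with w hw hws
  have hlim : Tendsto (fun x => F x w) atTop (𝓝 (K w)) :=
    (h w hws).comp (tendsto_id.prodMk tendsto_const_nhds)
  refine Metric.isClosed_closedBall.mem_of_tendsto hlim ?_
  filter_upwards [hU] with x hx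
  exact hUV (mk_mem_prod hx hw)

end Kernel

/-! ### The kernel `K` and its equation -/

theorem mainTheorem10 (φ η f g : ℝ → ℝ) (a : ℚ → ℝ) (B : Set ℝ)
    (hφ : SelfEquivarying φ η) (hφc : ContinuousOn φ (Ioi 0))
    (hB : B ⊆ Ioi 0) (hBm : NullMeasurableSet B volume) (hB0 : volume B ≠ 0)
    (hf : ∀ x, 0 < x → 0 < f x) (hfm : AEMeasurable f (volume.restrict (Ioi 0)))
    (hg : ∀ t ∈ B, 0 < g t)
    (hK : KendallAlongRat φ f a B g) :
    ∃ K : ℝ → ℝ, (∀ t, 0 < t → 0 < K t) ∧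
      PhiRegularlyVarying φ f K ∧
      (∀ t, 0 < t → Tendsto (fun x : ℝ => f (x + t * φ x) / f x) atTop (𝓝 (K t))) ∧
      ContinuousOn K (Ioi 0) ∧
      ChudziakJablonska η K := by
  have hinc {s t : ℝ} (hs : s ∈ B) (ht : t ∈ B) := hK.hasLogIncrement hφ hφc hB hf hg hs ht
  have h0 : HasLogIncrement φ f 0 0 := by
    obtain ⟨s, hs, -⟩ := exists_pair_close hB0 one_pos
    simpa using hinc hs hs
  have hsmall : ∀ ε > 0, ∃ u k, 0 < u ∧ u < ε ∧ HasLogIncrement φ f u k := by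
    intro ε hε
    obtain ⟨s, hs, t, ht, hst, hlt⟩ := exists_pair_close hB0 hε
    have hη := hφ.one_le_limit hφc (hB hs)
    have hst' : 0 < t - s := sub_pos.2 hst
    exact ⟨_, _, by positivity, (div_le_self hst'.le hη).trans_lt hlt, hinc hs ht⟩
  have hall : ∀ T, ∃ k, 0 < T → HasLogIncrement φ f T k := by
    intro T
    by_cases hT : 0 < T
    · obtain ⟨k, hk⟩ := HasLogIncrement.exists_of_approx hφ hφc h0 fun ε hε =>
        HasLogIncrement.exists_close hφ hφc hsmall hT hε
      exact ⟨k, fun _ => hk⟩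
    · exact ⟨0, fun h => absurd h hT⟩
  choose k hk using hall
  have hlim : ∀ t ∈ Ioi (0 : ℝ), Tendsto (fun p : ℝ × ℝ => f (popa φ p.1 p.2) / f p.1)
      (atTop ×ˢ 𝓝 t) (𝓝 (Real.exp (k t))) := by
    intro t ht
    refine ((Real.continuous_exp.tendsto _).comp (hk t ht)).congr' ?_
    have hx : Tendsto (fun p : ℝ × ℝ => p.1) (atTop ×ˢ 𝓝 t) atTop := tendsto_fst
    have hw : Tendsto (fun p : ℝ × ℝ => p.2) (atTop ×ˢ 𝓝 t) (𝓝 t) := tendsto_snd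
    filter_upwards [hx.eventually_gt_atTop 0, hw.eventually (lt_mem_nhds ht)] with p h1 h2
    simp only [Function.comp]
    rw [Real.exp_sub, Real.exp_log (hf _ (h1.trans_le (hφ.le_popa h1 h2.le))),
      Real.exp_log (hf _ h1)]
  have hcont : ContinuousOn (fun t => Real.exp (k t)) (Ioi 0) :=
    continuousOn_of_tendsto_prod (F := fun x t => f (popa φ x t) / f x) isOpen_Ioi hlim
  refine ⟨fun t => Real.exp (k t), fun t _ => Real.exp_pos _, ?_, ?_, hcont, ?_⟩
  · refine tendstoLocallyUniformlyOn_iff_forall_tendsto.2 fun t ht => ?_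
    rw [nhdsWithin_eq_nhds.2 (Ioi_mem_nhds ht)]
    have h2 : Tendsto (fun p : ℝ × ℝ => Real.exp (k p.2)) (atTop ×ˢ 𝓝 t) (𝓝 (Real.exp (k t))) :=
      (hcont.continuousAt (Ioi_mem_nhds ht)).tendsto.comp tendsto_snd
    exact (h2.prodMk_nhds (hlim t ht)).mono_right (nhds_le_uniformity _)
  · exact fun t ht => (hlim t ht).comp (tendsto_id.prodMk tendsto_const_nhds)
  · intro u v hu hv
    have huv : 0 < popa η u v := by
      have := mul_pos hv (one_pos.trans_le (hφ.one_le_limit hφc hu))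
      simp only [popa]
      linarith
    have := tendsto_nhds_unique (hk _ huv) ((hk u hu).comp hφ hφc hu (hk v hv))
    simp only [this, Real.exp_add, mul_comm]
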